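/- Call $(G,\mathcal B,\mu,\mathcal B_2,\mu_2)$ a \emph{probability group} if $G$ is a group, $\mathcal B$ and $\mathcal B_2\supseteq \mathcal B\times\mathcal B$ are $\sigma$-algebras on $G$ and $G^2$, and $\mu,\mu_2$ are probability measures on $\mathcal B,\mathcal B_2$ with $\mu_2|_{\mathcal B\times\mathcal B}=\mu\times\mu$, such that (i) multiplication $(G^2,\mathcal B_2)\to(G,\mathcal B)$ is measurable; (ii) inversion $(G,\mathcal B)\to(G,\mathcal B)$ is measurable; (iii) $\mu$ is invariant under left and right translations and under inversion; (iv) Fubini's theorem holds for $\mathcal B_2$-measurable functions $f$ on $G^2$: for every $g\in G$ the sections $f(g,\cdot)$ and $f(\cdot,g)$ are $\mathcal B$-measurable; the functions $g\mapsto\int_G f(g,h)\,d\mu(h)$ and $g\mapsto\int_G f(h,g)\,d\mu(h)$ are $\mathcal B$-measurable (the integral of a non-integrable real function being read as $0$); and $$\int_G\int_G f(g,h)\,d\mu(g)\,d\mu(h)=\int_{G^2}f\,d\mu_2=\int_G\int_G f(g,h)\,d\mu(h)\,d\mu(g)$$ whenever $f$ takes values in $[0,\infty]$ or is real-valued and $\mu_2$-integrable;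 in the latter case, moreover, the sections $f(g,\cdot)$ and $f(\cdot,g)$ are $\mu$-integrable for $\mu$-almost every $g$, and the partial integrals are $\mu$-integrable. Let $\alpha$ be an ultrafilter on $\mathbb N$, let $(G_n,\mathcal B^{(n)},\mu^{(n)},\mathcal B^{(n)}_2,\mu^{(n)}_2)_{n\in\mathbb N}$ be a sequence of probability groups, and let $G=\prod_{n\to\alpha}G_n$ be the ultraproduct group; identify $G^2$ with $\prod_{n\to\alpha}G_n^2$. Let $\mathcal B$ be the $\sigma$-algebra on $G$ generated by the internal sets $\prod_{n\to\alpha}A_n$ with $A_n\in\mathcal B^{(n)}$, and let $\mathcal B_2$ be the $\sigma$-algebra on $G^2$ generated by the internal sets $\prod_{n\to\alpha}A_n$ with $A_n\in\mathcal B^{(n)}_2$. Let $\mu$ be the Loeb measure on $\mathcal B$, that is, the restriction to $\mathcal B$ of the outer measure $$\mu^*(S)=\inf\Big\{\sum_{k}\lim_{n\to\alpha}\mu^{(n)}(A^k_n)\;:\; S\subseteq\bigcup_{k\in\mathbb N}\prod_{n\to\alpha}A^k_n,\ A^k_n\in\mathcal B^{(n)}\Big\},$$ and let $\mu_2$ be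 the Loeb measure on $\mathcal B_2$ obtained in the same way from the $\mu_2^{(n)}$. Then these measures extend the limits of the given ones, i.e. $\mu(\prod_{n\to\alpha}A_n)=\lim_{n\to\alpha}\mu^{(n)}(A_n)$ for all $A_n\in\mathcal B^{(n)}$ and $\mu_2(\prod_{n\to\alpha}A_n)=\lim_{n\to\alpha}\mu_2^{(n)}(A_n)$ for all $A_n\in\mathcal B_2^{(n)}$, and $(G,\mathcal B,\mu,\mathcal B_2,\mu_2)$ is a probability group. -/

import Mathlib

open MeasureTheory Filter Topology
open scoped ENNReal

/-- Fubini's theorem for a probability measure `μ` on `(G, B)` and a measure `μ₂` on `(G × G, B₂)`,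
where `B₂` is not assumed to be the product `σ`-algebra.

The integral of a real function is the Bochner integral, which is `0` for a function that is not
integrable; the integral identities are required of nonnegative functions (with values in `[0, ∞]`)
and of integrable real functions. -/
structure FubiniHolds {G : Type*} (B : MeasurableSpace G) (μ : @Measure G B)
    (B₂ : MeasurableSpace (G × G)) (μ₂ : @Measure (G × G) B₂) : Prop where
  /-- all sections of a measurable function are measurable -/
  measurable_sections : ∀ f : G × G → ℝ, Measurable[B₂] f →
    ∀ g : G, (Measurable[B] fun h => f (g, h)) ∧ (Measurable[B] fun h => f (h, g))
  /-- the partial integrals of a measurable function are measurable -/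
  measurable_integral : ∀ f : G × G → ℝ, Measurable[B₂] f →
    (Measurable[B] fun g => ∫ h, f (g, h) ∂μ) ∧ (Measurable[B] fun g => ∫ h, f (h, g) ∂μ)
  /-- measurability and equality of the iterated integrals, for nonnegative functions -/
  lintegral_eq : ∀ f : G × G → ℝ≥0∞, Measurable[B₂] f →
    (Measurable[B] fun g => ∫⁻ h, f (g, h) ∂μ) ∧ (Measurable[B] fun g => ∫⁻ h, f (h, g) ∂μ) ∧
    ∫⁻ h, ∫⁻ g, f (g, h) ∂μ ∂μ = ∫⁻ p, f p ∂μ₂ ∧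
    ∫⁻ p, f p ∂μ₂ = ∫⁻ g, ∫⁻ h, f (g, h) ∂μ ∂μ
  /-- almost all sections of an integrable function are integrable -/
  ae_integrable : ∀ f : G × G → ℝ, Measurable[B₂] f → Integrable f μ₂ →
    (∀ᵐ g ∂μ, Integrable (fun h => f (g, h)) μ) ∧ (∀ᵐ g ∂μ, Integrable (fun h => f (h, g)) μ)
  /-- the partial integrals of an integrable function are integrable -/
  integrable_integral : ∀ f : G × G → ℝ, Measurable[B₂] f → Integrable f μ₂ →
    Integrable (fun g => ∫ h, f (g, h) ∂μ) μ ∧ Integrable (fun g => ∫ h, f (h, g) ∂μ) μ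
  /-- equality of the iterated integrals, for integrable functions -/
  integral_eq : ∀ f : G × G → ℝ, Measurable[B₂] f → Integrable f μ₂ →
    ∫ h, ∫ g, f (g, h) ∂μ ∂μ = ∫ p, f p ∂μ₂ ∧
    ∫ p, f p ∂μ₂ = ∫ g, ∫ h, f (g, h) ∂μ ∂μ

/-- `(G, B, μ, B₂, μ₂)` is a probability group. -/
structure IsProbabilityGroup (G : Type*) [Group G] (B : MeasurableSpace G) (μ : @Measure G B)
    (B₂ : MeasurableSpace (G × G)) (μ₂ : @Measure (G × G) B₂) : Prop where
  isProbabilityMeasure : @IsProbabilityMeasure G B μ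
  isProbabilityMeasure₂ : @IsProbabilityMeasure (G × G) B₂ μ₂
  prod_le : B.prod B ≤ B₂
  trim_eq_prod : @Measure.trim (G × G) (B.prod B) B₂ μ₂ prod_le = @Measure.prod G G B B μ μ
  measurable_mul : @Measurable (G × G) G B₂ B fun p => p.1 * p.2
  measurable_inv : @Measurable G G B B fun g => g⁻¹
  mul_left_invariant : ∀ (g : G) (A : Set G), MeasurableSet[B] A → μ ((fun h => g * h) ⁻¹' A) = μ A
  mul_right_invariant : ∀ (g : G) (A : Set G), MeasurableSet[B] A → μ ((fun h => h * g) ⁻¹' A) = μ A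
  inv_invariant : ∀ A : Set G, MeasurableSet[B] A → μ ((fun h => h⁻¹) ⁻¹' A) = μ A
  fubini : FubiniHolds B μ B₂ μ₂

/-- The ultraproduct `∏_{n → α} X n`: sequences modulo equality for `α`-almost all `n`. -/
abbrev Ultraproduct (α : Ultrafilter ℕ) (X : ℕ → Type*) : Type _ :=
  (α : Filter ℕ).Product X

namespace Ultraproduct

/-- The class of a sequence in the ultraproduct. -/
def mk (α : Ultrafilter ℕ) {X : ℕ → Type*} (x : ∀ n, X n) : Ultraproduct α X :=
  Quotient.mk ((α : Filter ℕ).productSetoid X) x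

/-- The coordinatewise group structure on an ultraproduct of groups. -/
instance instGroup (α : Ultrafilter ℕ) (G : ℕ → Type*) [∀ n, Group (G n)] :
    Group (Ultraproduct α G) where
  mul := Quotient.map₂ (fun x y n => x n * y n) fun _ _ hx _ _ hy => by
    filter_upwards [hx, hy] with n h₁ h₂
    simp only [h₁, h₂]
  one := mk α fun _ => 1
  inv := Quotient.map (fun x n => (x n)⁻¹) fun _ _ hx => by
    filter_upwards [hx] with n h
    simp only [h]
  mul_assoc := by
    rintro ⟨x⟩ ⟨y⟩ ⟨z⟩
    exact congrArg (mk α) (funext fun n => mul_assoc (x n) (y n) (z n))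
  one_mul := by
    rintro ⟨x⟩
    exact congrArg (mk α) (funext fun n => one_mul (x n))
  mul_one := by
    rintro ⟨x⟩
    exact congrArg (mk α) (funext fun n => mul_one (x n))
  inv_mul_cancel := by
    rintro ⟨x⟩
    exact congrArg (mk α) (funext fun n => inv_mul_cancel (x n))

section Loeb

variable (α : Ultrafilter ℕ) {X : ℕ → Type*}

/-- The internal set `∏_{n → α} A n`. -/
def internalSet (A : ∀ n, Set (X n)) : Set (Ultraproduct α X) :=
  {x | Quotient.liftOn x (fun a => ∀ᶠ n in (α : Filter ℕ), a n ∈ A n) fun a b hab =>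
    propext (eventually_congr (by
      filter_upwards [hab] with n h
      rw [h]))}

/-- The Loeb `σ`-algebra on `∏_{n → α} X n`: it is generated by the internal sets
`∏_{n → α} A n` with `A n ∈ B n` (and is not completed). -/
@[reducible] def loebSpace (B : ∀ n, MeasurableSpace (X n)) : MeasurableSpace (Ultraproduct α X) :=
  MeasurableSpace.generateFrom
    {S | ∃ A : ∀ n, Set (X n), (∀ n, MeasurableSet[B n] (A n)) ∧ S = internalSet α A}

/-- The Loeb premeasure `∏_{n → α} A n ↦ lim_{n → α} μ n (A n)` on internal sets with `A n ∈ B n`;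
its value is `∞` on all other sets. -/
noncomputable def loebPremeasure (B : ∀ n, MeasurableSpace (X n)) (μ : ∀ n, @Measure (X n) (B n))
    (S : Set (Ultraproduct α X)) : ℝ≥0∞ :=
  ⨅ (A : ∀ n, Set (X n)) (_ : ∀ n, MeasurableSet[B n] (A n)) (_ : S = internalSet α A),
    limUnder (α : Filter ℕ) fun n => μ n (A n)

theorem tendsto_limUnder (u : ℕ → ℝ≥0∞) :
    Tendsto u (α : Filter ℕ) (𝓝 (limUnder (α : Filter ℕ) u)) := by
  obtain ⟨l, -, hl⟩ := (isCompact_univ (X := ℝ≥0∞)).ultrafilter_le_nhds (α.map u) (by simp)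
  exact tendsto_nhds_limUnder ⟨l, hl⟩

theorem loebPremeasure_empty (B : ∀ n, MeasurableSpace (X n)) (μ : ∀ n, @Measure (X n) (B n)) :
    loebPremeasure α B μ ∅ = 0 := by
  refine le_antisymm ?_ bot_le
  refine iInf_le_of_le (fun _ => ∅) (iInf_le_of_le (fun _ => MeasurableSet.empty)
    (iInf_le_of_le ?_ ?_))
  · symm
    rw [Set.eq_empty_iff_forall_notMem]
    rintro ⟨x⟩ hx
    have hx' : ∀ᶠ n in (α : Filter ℕ), x n ∈ (∅ : Set (X n)) := hx
    simp only [Set.mem_empty_iff_false, eventually_false_iff_eq_bot] at hx'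
    exact α.neBot.ne hx'
  · simp only [measure_empty]
    exact (tendsto_nhds_unique (tendsto_limUnder α _) tendsto_const_nhds).le

/-- The outer measure of the Loeb construction: the infimum of `∑ₖ lim_{n → α} μ n (A k n)` over the
countable covers by internal sets `∏_{n → α} A k n` with `A k n ∈ B n`. -/
noncomputable def loebOuterMeasure (B : ∀ n, MeasurableSpace (X n))
    (μ : ∀ n, @Measure (X n) (B n)) : OuterMeasure (Ultraproduct α X) :=
  OuterMeasure.ofFunction (loebPremeasure α B μ) (loebPremeasure_empty α B μ)

theorem loebSpace_le_caratheodory (B : ∀ n, MeasurableSpace (X n))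
    (μ : ∀ n, @Measure (X n) (B n)) :
    loebSpace α B ≤ (loebOuterMeasure α B μ).caratheodory := by
  refine MeasurableSpace.generateFrom_le ?_
  rintro S ⟨A, hA, rfl⟩
  refine OuterMeasure.ofFunction_caratheodory fun T => ?_
  refine le_iInf fun C => le_iInf fun hC => le_iInf fun hT => ?_
  subst hT
  have h₁ : loebPremeasure α B μ (internalSet α C ∩ internalSet α A) ≤
      limUnder (α : Filter ℕ) fun n => μ n (C n ∩ A n) := by
    refine iInf_le_of_le (fun n => C n ∩ A n) (iInf_le_of_le (fun n => (hC n).inter (hA n))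
      (iInf_le_of_le ?_ le_rfl))
    ext ⟨x⟩
    exact (eventually_and (f := (α : Filter ℕ)) (p := fun n => x n ∈ C n)
      (q := fun n => x n ∈ A n)).symm
  have h₂ : loebPremeasure α B μ (internalSet α C \ internalSet α A) ≤
      limUnder (α : Filter ℕ) fun n => μ n (C n \ A n) := by
    refine iInf_le_of_le (fun n => C n \ A n) (iInf_le_of_le (fun n => (hC n).diff (hA n))
      (iInf_le_of_le ?_ le_rfl))
    ext ⟨x⟩
    exact (and_congr Iff.rfl (Ultrafilter.eventually_not (f := α)
      (p := fun n => x n ∈ A n)).symm).trans (eventually_and (f := (α : Filter ℕ))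
      (p := fun n => x n ∈ C n) (q := fun n => ¬ x n ∈ A n)).symm
  refine (add_le_add h₁ h₂).trans (le_of_eq ?_)
  refine tendsto_nhds_unique ((tendsto_limUnder α _).add (tendsto_limUnder α _)) ?_
  simp only [measure_inter_add_sdiff _ (hA _)]
  exact tendsto_limUnder α _

/-- The Loeb measure on `∏_{n → α} X n` induced by the measures `μ n`: the restriction to the Loeb
`σ`-algebra of the outer measure generated by the Loeb premeasure. -/
noncomputable def loebMeasure (B : ∀ n, MeasurableSpace (X n)) (μ : ∀ n, @Measure (X n) (B n)) :
    @Measure (Ultraproduct α X) (loebSpace α B) :=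
  @OuterMeasure.toMeasure _ (loebSpace α B) (loebOuterMeasure α B μ)
    (loebSpace_le_caratheodory α B μ)

end Loeb

section Square

variable (α : Ultrafilter ℕ) {G : ℕ → Type*}

/-- The canonical bijection from `∏_{n → α} (G n)²` to `(∏_{n → α} G n)²`. -/
def toSquare : Ultraproduct α (fun n => G n × G n) → Ultraproduct α G × Ultraproduct α G :=
  fun p =>
    (Quotient.map (fun (x : ∀ n, G n × G n) n => (x n).1)
        (fun _ _ h => by
          filter_upwards [h] with n e
          rw [e]) p,
      Quotient.map (fun (x : ∀ n, G n × G n) n => (x n).2)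
        (fun _ _ h => by
          filter_upwards [h] with n e
          rw [e]) p)

theorem toSquare_bijective : Function.Bijective (toSquare α (G := G)) := by
  constructor
  · rintro ⟨x⟩ ⟨y⟩ h
    have h₁ := Quotient.exact (congrArg Prod.fst h)
    have h₂ := Quotient.exact (congrArg Prod.snd h)
    refine Quotient.sound ?_
    filter_upwards [h₁, h₂] with n e₁ e₂
    exact Prod.ext e₁ e₂
  · rintro ⟨⟨x⟩, ⟨y⟩⟩
    exact ⟨mk α fun n => (x n, y n), rfl⟩

/-- The Loeb `σ`-algebra of `∏_{n → α} (G n)²`, carried over to `(∏_{n → α} G n)²`. -/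
@[reducible] def loebSpaceSquare (B₂ : ∀ n, MeasurableSpace (G n × G n)) :
    MeasurableSpace (Ultraproduct α G × Ultraproduct α G) :=
  (loebSpace α B₂).map (toSquare α)

/-- The Loeb measure of `∏_{n → α} (G n)²`, carried over to `(∏_{n → α} G n)²`. -/
noncomputable def loebMeasureSquare (B₂ : ∀ n, MeasurableSpace (G n × G n))
    (μ₂ : ∀ n, @Measure (G n × G n) (B₂ n)) :
    @Measure (Ultraproduct α G × Ultraproduct α G) (loebSpaceSquare α B₂) :=
  @Measure.map _ _ (loebSpace α B₂) (loebSpaceSquare α B₂) (toSquare α) (loebMeasure α B₂ μ₂)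

end Square

end Ultraproduct

/-!
The Loeb premeasure is countably additive because of saturation: over a non-principal ultrafilter a
countable cover of an internal set by internal sets has a finite subcover
(`exists_eventually_subset_iUnion`), while over a principal ultrafilter the ultraproduct is one of
the factors. Hence the Loeb measure of an internal set is the limit of the measures
(`tendsto_loebMeasure`).

Translations, inversion, multiplication and the coordinate projections are internal maps, which
carry internal sets back to internal sets. As these form a `π`-system generating the Loeb
`σ`-algebra, measurability (`measurable_of_mk`) and invariance (`measurePreserving_of_mk`) pass from
the factors to the ultraproduct.

Fubini's theorem for all measurable functions is equivalent to Fubini's theorem for measurable sets,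
that is, to `μ₂` being the integral of the images of `μ` under `h ↦ (g, h)`, and likewise for
`h ↦ (h, g)` (`fubiniHolds_iff_isDisintegration`); the sections then form a Markov kernel, and the
theory of kernels yields the integral identities. By the `π`-`λ` theorem it suffices to consider
internal sets. For an internal set `∏ A n`, the measure of the section at the class of `x` is the
limit of the measures of the sections of `A n` at `x n`. These are functions with values in
`[0, 1]`, whose limit is measurable and has as its integral the limit of the integrals
(`tendsto_lintegral_loebMeasure`, by approximation with step functions). So Fubini's theorem in the
factors passes to the limit (`isDisintegration_map₂`).

The product `σ`-algebra is generated by rectangles, and Fubini's theorem for the indicator of a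
rectangle shows that `μ₂` extends `μ × μ` (`IsDisintegration.trim_eq_prod`).
-/

/-! ### Internal sets and saturation -/

namespace Ultraproduct

variable {α : Ultrafilter ℕ} {X : ℕ → Type*}

theorem mk_mem_internalSet {x : ∀ n, X n} {A : ∀ n, Set (X n)} :
    mk α x ∈ internalSet α A ↔ ∀ᶠ n in (α : Filter ℕ), x n ∈ A n :=
  Iff.rfl

theorem mk_surjective : Function.Surjective (mk α (X := X)) :=
  Quotient.mk_surjective

theorem internalSet_inter (A C : ∀ n, Set (X n)) :
    internalSet α A ∩ internalSet α C = internalSet α fun n => A n ∩ C n := by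
  ext x
  obtain ⟨x, rfl⟩ := mk_surjective x
  exact eventually_and.symm

theorem internalSet_univ : internalSet α (fun n => (Set.univ : Set (X n))) = Set.univ := by
  ext x
  obtain ⟨x, rfl⟩ := mk_surjective x
  simp [mk_mem_internalSet]

theorem measurableSet_internalSet {B : ∀ n, MeasurableSpace (X n)} {A : ∀ n, Set (X n)}
    (hA : ∀ n, MeasurableSet[B n] (A n)) : MeasurableSet[loebSpace α B] (internalSet α A) :=
  MeasurableSpace.measurableSet_generateFrom ⟨A, hA, rfl⟩

theorem isPiSystem_internalSet (B : ∀ n, MeasurableSpace (X n)) :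
    IsPiSystem {S | ∃ A : ∀ n, Set (X n), (∀ n, MeasurableSet[B n] (A n)) ∧
      S = internalSet α A} := by
  rintro _ ⟨A, hA, rfl⟩ _ ⟨C, hC, rfl⟩ -
  exact ⟨fun n => A n ∩ C n, fun n => (hA n).inter (hC n), internalSet_inter A C⟩

theorem measurable_loebSpace {Y : Type*} {m : MeasurableSpace Y} {B : ∀ n, MeasurableSpace (X n)}
    {u : Y → Ultraproduct α X} (h : ∀ A : ∀ n, Set (X n), (∀ n, MeasurableSet[B n] (A n)) →
      MeasurableSet (u ⁻¹' internalSet α A)) : Measurable[m, loebSpace α B] u := by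
  refine @measurable_generateFrom _ _ m _ _ ?_
  rintro _ ⟨A, hA, rfl⟩
  exact h A hA

theorem eventually_subset_of_internalSet_subset [∀ n, Nonempty (X n)] {A C : ∀ n, Set (X n)}
    (h : internalSet α A ⊆ internalSet α C) : ∀ᶠ n in (α : Filter ℕ), A n ⊆ C n := by
  by_contra hn
  rw [← Ultrafilter.eventually_not] at hn
  have hx : ∀ n, ∃ x, ¬ A n ⊆ C n → x ∈ A n ∧ x ∉ C n := fun n => by
    by_cases hs : A n ⊆ C n
    · exact ⟨Classical.arbitrary _, fun h => absurd hs h⟩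
    · obtain ⟨x, hx⟩ := Set.not_subset.1 hs
      exact ⟨x, fun _ => hx⟩
  choose x hx using hx
  have hA : mk α x ∈ internalSet α A := hn.mono fun n h => (hx n h).1
  obtain ⟨n, h₁, h₂⟩ := (hn.and (h hA)).exists
  exact (hx n h₁).2 h₂

/-- `ℵ₁`-saturation: over a non-principal ultrafilter, a countable cover of an internal set by
internal sets has a finite subcover. -/
theorem exists_eventually_subset_iUnion [∀ n, Nonempty (X n)] (hα : (α : Filter ℕ) ≤ cofinite)
    {A : ∀ n, Set (X n)} {C : ℕ → ∀ n, Set (X n)}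
    (h : internalSet α A ⊆ ⋃ k, internalSet α (C k)) :
    ∃ K : ℕ, ∀ᶠ n in (α : Filter ℕ), A n ⊆ ⋃ k ∈ Finset.range K, C k n := by
  classical
  by_contra hK
  simp only [not_exists, ← Ultrafilter.eventually_not] at hK
  let D : ℕ → ∀ n, Set (X n) := fun K n => A n \ ⋃ k ∈ Finset.range K, C k n
  have hD : ∀ K, ∀ᶠ n in (α : Filter ℕ), (D K n).Nonempty := fun K =>
    (hK K).mono fun n hn => Set.sdiff_nonempty.2 hn
  -- The diagonal sequence takes `x n` in the last nonempty `D K n` with `K ≤ n`.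
  let κ : ℕ → ℕ := fun n => Nat.findGreatest (fun K => (D K n).Nonempty) n
  have hx : ∀ n, ∃ x, (D (κ n) n).Nonempty → x ∈ D (κ n) n := fun n => by
    by_cases hs : (D (κ n) n).Nonempty
    · exact ⟨hs.some, fun _ => hs.some_mem⟩
    · exact ⟨Classical.arbitrary _, fun h => absurd h hs⟩
  choose x hx using hx
  have hxD : ∀ K, ∀ᶠ n in (α : Filter ℕ), x n ∈ D K n := fun K => by
    have hge : ∀ᶠ n in (α : Filter ℕ), K ≤ n :=
      hα (by rw [Nat.cofinite_eq_atTop]; exact eventually_ge_atTop K)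
    filter_upwards [hge, hD K] with n hn hne
    have h₁ : K ≤ κ n := Nat.le_findGreatest hn hne
    have h₂ := hx n (Nat.findGreatest_spec (P := fun K => (D K n).Nonempty) hn hne)
    refine ⟨h₂.1, fun hmem => h₂.2 ?_⟩
    exact Set.biUnion_subset_biUnion_left (Finset.range_subset_range.2 h₁) hmem
  have hA : mk α x ∈ internalSet α A := (hxD 0).mono fun n h => h.1
  obtain ⟨k, hk⟩ := Set.mem_iUnion.1 (h hA)
  obtain ⟨n, h₁, h₂⟩ := ((hxD (k + 1)).and hk).exists
  exact h₁.2 (Set.mem_biUnion (by simp : k ∈ Finset.range (k + 1)) h₂)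

/-- The limit of the measures is countably subadditive on internal sets. Over a principal
ultrafilter this is the countable subadditivity of one of the measures; over a non-principal one
saturation reduces it to a finite cover. -/
theorem limUnder_measure_le_tsum [∀ n, Nonempty (X n)] {B : ∀ n, MeasurableSpace (X n)}
    (μ : ∀ n, @Measure (X n) (B n)) {A : ∀ n, Set (X n)} {C : ℕ → ∀ n, Set (X n)}
    (h : internalSet α A ⊆ ⋃ k, internalSet α (C k)) :
    limUnder (α : Filter ℕ) (fun n => μ n (A n)) ≤
      ∑' k, limUnder (α : Filter ℕ) fun n => μ n (C k n) := by
  classical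
  rcases α.le_cofinite_or_eq_pure with hα | ⟨m, rfl⟩
  · obtain ⟨K, hK⟩ := exists_eventually_subset_iUnion hα h
    refine le_trans ?_ (ENNReal.sum_le_tsum (Finset.range K))
    refine le_of_tendsto_of_tendsto (tendsto_limUnder α _)
      (tendsto_finsetSum _ fun k _ => tendsto_limUnder α _) ?_
    filter_upwards [hK] with n hn
    exact (measure_mono hn).trans (measure_biUnion_finset_le _ _)
  · have hlim : ∀ u : ℕ → ℝ≥0∞, limUnder ((pure m : Ultrafilter ℕ) : Filter ℕ) u = u m := fun u =>
      tendsto_nhds_unique (tendsto_limUnder _ u) (tendsto_pure_nhds u m)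
    simp only [hlim]
    refine (measure_mono fun a ha => ?_).trans (measure_iUnion_le _)
    let x : ∀ n, X n := Function.update (fun n => Classical.arbitrary (X n)) m a
    have hx : x m = a := Function.update_self ..
    have hA : mk (pure m) x ∈ internalSet (pure m) A := by
      change ∀ᶠ n in pure m, x n ∈ A n
      simpa [hx] using ha
    obtain ⟨k, hk⟩ := Set.mem_iUnion.1 (h hA)
    have hk : ∀ᶠ n in pure m, x n ∈ C k n := hk
    exact Set.mem_iUnion.2 ⟨k, by simpa [hx] using hk⟩

/-! ### The Loeb measure of an internal set -/

/-- The premeasure does not depend on the sequence of sets that represents an internal set, since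
such a sequence is determined up to equality almost everywhere. -/
theorem loebPremeasure_internalSet [∀ n, Nonempty (X n)] {B : ∀ n, MeasurableSpace (X n)}
    (μ : ∀ n, @Measure (X n) (B n)) {A : ∀ n, Set (X n)} (hA : ∀ n, MeasurableSet[B n] (A n)) :
    loebPremeasure α B μ (internalSet α A) = limUnder (α : Filter ℕ) fun n => μ n (A n) := by
  refine le_antisymm (iInf_le_of_le A (iInf_le_of_le hA (iInf_le_of_le rfl le_rfl))) ?_
  refine le_iInf fun C => le_iInf fun _ => le_iInf fun h => ?_
  refine le_of_tendsto_of_tendsto (tendsto_limUnder α _) (tendsto_limUnder α _) ?_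
  filter_upwards [eventually_subset_of_internalSet_subset h.le] with n hn
  exact measure_mono hn

theorem loebMeasure_internalSet [∀ n, Nonempty (X n)] {B : ∀ n, MeasurableSpace (X n)}
    (μ : ∀ n, @Measure (X n) (B n)) {A : ∀ n, Set (X n)} (hA : ∀ n, MeasurableSet[B n] (A n)) :
    loebMeasure α B μ (internalSet α A) = limUnder (α : Filter ℕ) fun n => μ n (A n) := by
  let _ := loebSpace α B
  rw [loebMeasure, toMeasure_apply _ _ (measurableSet_internalSet hA)]
  refine le_antisymm ((OuterMeasure.ofFunction_le _).trans (loebPremeasure_internalSet μ hA).le) ?_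
  rw [loebOuterMeasure, OuterMeasure.ofFunction_apply]
  refine le_iInf₂ fun t ht => ?_
  by_cases htop : ∃ k, loebPremeasure α B μ (t k) = ∞
  · obtain ⟨k, hk⟩ := htop
    rw [ENNReal.tsum_eq_top_of_eq_top ⟨k, hk⟩]
    exact le_top
  · push Not at htop
    -- The premeasure is infinite off the internal sets, so the cover consists of internal sets.
    have hC : ∀ k, ∃ C : ∀ n, Set (X n), (∀ n, MeasurableSet[B n] (C n)) ∧
        t k = internalSet α C := fun k => by
      by_contra! hk
      refine htop k (iInf_eq_top.2 fun C => iInf_eq_top.2 fun hC => iInf_eq_top.2 fun h => ?_)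
      exact absurd h (hk C hC)
    choose C hC htC using hC
    simp only [htC, loebPremeasure_internalSet μ (hC _)]
    exact limUnder_measure_le_tsum μ (ht.trans_eq (Set.iUnion_congr htC))

theorem tendsto_loebMeasure [∀ n, Nonempty (X n)] {B : ∀ n, MeasurableSpace (X n)}
    (μ : ∀ n, @Measure (X n) (B n)) {A : ∀ n, Set (X n)} (hA : ∀ n, MeasurableSet[B n] (A n)) :
    Tendsto (fun n => μ n (A n)) (α : Filter ℕ) (𝓝 (loebMeasure α B μ (internalSet α A))) := by
  rw [loebMeasure_internalSet μ hA]
  exact tendsto_limUnder α _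

theorem isProbabilityMeasure_loebMeasure [∀ n, Nonempty (X n)] {B : ∀ n, MeasurableSpace (X n)}
    {μ : ∀ n, @Measure (X n) (B n)} (hμ : ∀ n, IsProbabilityMeasure (μ n)) :
    IsProbabilityMeasure (loebMeasure α B μ) := by
  refine ⟨tendsto_nhds_unique ?_ (tendsto_const_nhds (f := (α : Filter ℕ)))⟩
  rw [← internalSet_univ]
  exact (tendsto_loebMeasure μ fun n => MeasurableSet.univ).congr fun n => (hμ n).measure_univ

/-! ### Integrals of limits of bounded functions -/

/-- The `k`-step minorant of the identity on `[0, 1]`, whose value at `t ∈ [0, 1]` is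
`⌊k t⌋ / k`. -/
noncomputable def stepMinorant (k : ℕ) (t : ℝ≥0∞) : ℝ≥0∞ :=
  ∑ j ∈ Finset.range k, (Set.Ici (((j + 1 : ℕ) : ℝ≥0∞) / k)).indicator (fun _ => (k : ℝ≥0∞)⁻¹) t

theorem stepMinorant_le_and_le_add {k : ℕ} (hk : k ≠ 0) {t : ℝ≥0∞} (ht : t ≤ 1) :
    stepMinorant k t ≤ t ∧ t ≤ stepMinorant k t + (k : ℝ≥0∞)⁻¹ := by
  lift t to NNReal using (ht.trans_lt ENNReal.one_lt_top).ne
  have ht' : t ≤ 1 := by exact_mod_cast ht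
  have hk0 : (k : ℝ≥0∞) ≠ 0 := by exact_mod_cast hk
  have hkt : (k : ℝ≥0∞) ≠ ∞ := ENNReal.natCast_ne_top k
  have hmem : ∀ j : ℕ, ((t : ℝ≥0∞) ∈ Set.Ici (((j + 1 : ℕ) : ℝ≥0∞) / k)) ↔ j < ⌊t * k⌋₊ := by
    intro j
    rw [Set.mem_Ici, ENNReal.div_le_iff hk0 hkt, ← Nat.add_one_le_iff, Nat.le_floor_iff (zero_le)]
    exact_mod_cast Iff.rfl
  have hfloor : ⌊t * k⌋₊ ≤ k := by
    refine Nat.floor_le_of_le ?_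
    simpa using mul_le_mul_left ht' (k : NNReal)
  have hval : stepMinorant k t = (⌊t * k⌋₊ : ℝ≥0∞) / k := by
    classical
    have hfilter : (Finset.range k).filter (fun j => j < ⌊t * k⌋₊) = Finset.range ⌊t * k⌋₊ := by
      ext j
      simp only [Finset.mem_filter, Finset.mem_range]
      omega
    simp only [stepMinorant, Set.indicator_apply, hmem]
    rw [← Finset.sum_filter, hfilter, Finset.sum_const, Finset.card_range, nsmul_eq_mul,
      div_eq_mul_inv]
  rw [hval]
  constructor
  · rw [ENNReal.div_le_iff hk0 hkt]
    exact_mod_cast Nat.floor_le zero_le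
  · rw [← one_div, ← ENNReal.add_div, ENNReal.le_div_iff_mul_le (Or.inl hk0) (Or.inl hkt)]
    exact_mod_cast (Nat.lt_floor_add_one (t * k)).le

theorem lintegral_stepMinorant {Y : Type*} {m : MeasurableSpace Y} (ν : Measure Y) {F : Y → ℝ≥0∞}
    (hF : Measurable F) (k : ℕ) :
    ∫⁻ y, stepMinorant k (F y) ∂ν =
      ∑ j ∈ Finset.range k, (k : ℝ≥0∞)⁻¹ * ν {y | ((j + 1 : ℕ) : ℝ≥0∞) / k ≤ F y} := by
  have hmeas : ∀ j ∈ Finset.range k, Measurable fun y =>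
      (Set.Ici (((j + 1 : ℕ) : ℝ≥0∞) / k)).indicator (fun _ => (k : ℝ≥0∞)⁻¹) (F y) :=
    fun j _ => (measurable_const.indicator measurableSet_Ici).comp hF
  simp only [stepMinorant]
  rw [lintegral_finsetSum _ hmeas]
  refine Finset.sum_congr rfl fun j _ => ?_
  exact lintegral_indicator_const (hF measurableSet_Ici) _

/-- The pointwise limit of measurable functions along the ultrafilter is Loeb measurable. -/
theorem measurable_of_tendsto_mk {B : ∀ n, MeasurableSpace (X n)} {F : ∀ n, X n → ℝ≥0∞}
    (hF : ∀ n, Measurable (F n)) {φ : Ultraproduct α X → ℝ≥0∞}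
    (hφ : ∀ x : ∀ n, X n, Tendsto (fun n => F n (x n)) (α : Filter ℕ) (𝓝 (φ (mk α x)))) :
    Measurable[loebSpace α B] φ := by
  let _ := loebSpace α B
  obtain ⟨s, hs, hd⟩ := TopologicalSpace.exists_countable_dense ℝ≥0∞
  refine measurable_of_Iio fun c => ?_
  have heq : φ ⁻¹' Set.Iio c =
      ⋃ q ∈ s ∩ Set.Iio c, internalSet α fun n => F n ⁻¹' Set.Iic q := by
    ext x
    obtain ⟨x, rfl⟩ := mk_surjective x
    simp only [Set.mem_preimage, Set.mem_Iio, Set.mem_iUnion, exists_prop]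
    constructor
    · intro h
      obtain ⟨q, hq, h₁, h₂⟩ := hd.exists_between h
      exact ⟨q, ⟨hq, h₂⟩, ((hφ x).eventually_lt_const h₁).mono fun n hn => le_of_lt hn⟩
    · rintro ⟨q, ⟨-, h₂⟩, hx⟩
      exact (le_of_tendsto (hφ x) hx).trans_lt h₂
  rw [heq]
  exact MeasurableSet.biUnion (hs.mono Set.inter_subset_left) fun q _ =>
    measurableSet_internalSet fun n => hF n measurableSet_Iic

/-- The Loeb integral of a limit of functions with values in `[0, 1]` is the limit of the integrals.
Step functions reduce this to the values of the measures on internal sets. -/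
theorem tendsto_lintegral_loebMeasure [∀ n, Nonempty (X n)] {B : ∀ n, MeasurableSpace (X n)}
    {μ : ∀ n, @Measure (X n) (B n)} (hμ : ∀ n, IsProbabilityMeasure (μ n))
    {F : ∀ n, X n → ℝ≥0∞} (hF : ∀ n, Measurable (F n)) (hF1 : ∀ n x, F n x ≤ 1)
    {φ : Ultraproduct α X → ℝ≥0∞}
    (hφ : ∀ x : ∀ n, X n, Tendsto (fun n => F n (x n)) (α : Filter ℕ) (𝓝 (φ (mk α x)))) :
    Tendsto (fun n => ∫⁻ x, F n x ∂(μ n)) (α : Filter ℕ) (𝓝 (∫⁻ x, φ x ∂(loebMeasure α B μ))) := by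
  let _ := loebSpace α B
  have := isProbabilityMeasure_loebMeasure (α := α) hμ
  have hlim := tendsto_limUnder α fun n => ∫⁻ x, F n x ∂(μ n)
  set l := limUnder (α : Filter ℕ) fun n => ∫⁻ x, F n x ∂(μ n)
  -- `ψ k` is the limit of the step functions `stepMinorant k ∘ F n`, and `σ k` its integral. Both
  -- `l` and the integral of `φ` lie between `σ k` and `σ k + 1 / k`.
  let S : ℕ → ℕ → Set (Ultraproduct α X) := fun k j =>
    internalSet α fun n => {x | ((j + 1 : ℕ) : ℝ≥0∞) / k ≤ F n x}
  have hmeas : ∀ (k j : ℕ) n, MeasurableSet[B n] {x | ((j + 1 : ℕ) : ℝ≥0∞) / k ≤ F n x} :=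
    fun k j n => hF n measurableSet_Ici
  let ψ : ℕ → Ultraproduct α X → ℝ≥0∞ := fun k x =>
    ∑ j ∈ Finset.range k, (S k j).indicator (fun _ => (k : ℝ≥0∞)⁻¹) x
  let σ : ℕ → ℝ≥0∞ := fun k =>
    ∑ j ∈ Finset.range k, (k : ℝ≥0∞)⁻¹ * loebMeasure α B μ (S k j)
  have hψ : ∀ k, ∫⁻ x, ψ k x ∂(loebMeasure α B μ) = σ k := fun k => by
    simp only [ψ]
    rw [lintegral_finsetSum _ fun j _ =>
      measurable_const.indicator (measurableSet_internalSet (hmeas k j))]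
    exact Finset.sum_congr rfl fun j _ =>
      lintegral_indicator_const (measurableSet_internalSet (hmeas k j)) _
  have hψF : ∀ k (x : ∀ n, X n), Tendsto (fun n => stepMinorant k (F n (x n))) (α : Filter ℕ)
      (𝓝 (ψ k (mk α x))) := fun k x => by
    classical
    refine tendsto_finsetSum _ fun j _ => tendsto_nhds_of_eventually_eq ?_
    by_cases hx : mk α x ∈ S k j
    · filter_upwards [mk_mem_internalSet.1 hx] with n hn
      rw [Set.indicator_of_mem hx, Set.indicator_of_mem]
      exact hn
    · filter_upwards [Ultrafilter.eventually_not.2 hx] with n hn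
      rw [Set.indicator_of_notMem hx, Set.indicator_of_notMem]
      exact hn
  have hσ : ∀ k ≠ 0, Tendsto (fun n => ∫⁻ x, stepMinorant k (F n x) ∂(μ n)) (α : Filter ℕ)
      (𝓝 (σ k)) := fun k hk => by
    simp only [lintegral_stepMinorant _ (hF _)]
    exact tendsto_finsetSum _ fun j _ => ENNReal.Tendsto.const_mul
      (tendsto_loebMeasure μ (hmeas k j)) (Or.inr (by simpa using hk))
  have hσl : ∀ k ≠ 0, σ k ≤ l ∧ l ≤ σ k + (k : ℝ≥0∞)⁻¹ := fun k hk => by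
    constructor
    · exact le_of_tendsto_of_tendsto' (hσ k hk) hlim fun n =>
        lintegral_mono fun x => (stepMinorant_le_and_le_add hk (hF1 n x)).1
    · refine le_of_tendsto_of_tendsto' hlim ((hσ k hk).add_const _) fun n => ?_
      refine (lintegral_mono fun x => (stepMinorant_le_and_le_add hk (hF1 n x)).2).trans ?_
      rw [lintegral_add_right _ measurable_const]
      simp
  have hσφ : ∀ k ≠ 0, σ k ≤ ∫⁻ x, φ x ∂(loebMeasure α B μ) ∧
      ∫⁻ x, φ x ∂(loebMeasure α B μ) ≤ σ k + (k : ℝ≥0∞)⁻¹ := fun k hk => by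
    rw [← hψ]
    constructor
    · refine lintegral_mono fun x => ?_
      obtain ⟨x, rfl⟩ := mk_surjective x
      exact le_of_tendsto_of_tendsto' (hψF k x) (hφ x) fun n =>
        (stepMinorant_le_and_le_add hk (hF1 n (x n))).1
    · calc ∫⁻ x, φ x ∂(loebMeasure α B μ)
          ≤ ∫⁻ x, ψ k x + (k : ℝ≥0∞)⁻¹ ∂(loebMeasure α B μ) := lintegral_mono fun x => by
            obtain ⟨x, rfl⟩ := mk_surjective x
            exact le_of_tendsto_of_tendsto' (hφ x) ((hψF k x).add_const _) fun n =>
              (stepMinorant_le_and_le_add hk (hF1 n (x n))).2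
        _ = _ := by
            rw [lintegral_add_right _ measurable_const]
            simp
  have hinv : Tendsto (fun k : ℕ => ((k + 1 : ℕ) : ℝ≥0∞)⁻¹) atTop (𝓝 0) :=
    ENNReal.tendsto_inv_nat_nhds_zero.comp (tendsto_add_atTop_nat 1)
  have heq : l = ∫⁻ x, φ x ∂(loebMeasure α B μ) := by
    refine le_antisymm ?_ ?_
    · refine ge_of_tendsto'
        (by simpa only [add_zero] using hinv.const_add (∫⁻ x, φ x ∂(loebMeasure α B μ)))
        fun k => (hσl (k + 1) k.succ_ne_zero).2.trans ?_
      exact add_le_add_left (hσφ (k + 1) k.succ_ne_zero).1 _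
    · refine ge_of_tendsto' (by simpa only [add_zero] using hinv.const_add l)
        fun k => (hσφ (k + 1) k.succ_ne_zero).2.trans ?_
      exact add_le_add_left (hσl (k + 1) k.succ_ne_zero).1 _
  rwa [← heq]

end Ultraproduct

/-! ### Disintegrations and Fubini's theorem -/

/-- The measure `ρ` disintegrates over `μ` into the images of `ν` under the maps `u x`; for
`u = Prod.mk` this is Fubini's theorem for measurable sets. -/
structure IsDisintegration {X H Y : Type*} {mX : MeasurableSpace X} {mH : MeasurableSpace H}
    {mY : MeasurableSpace Y} (μ : Measure X) (ν : Measure H) (ρ : Measure Y) (u : X → H → Y) :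
    Prop where
  measurable_section : ∀ x, Measurable (u x)
  measurable_measure : ∀ A : Set Y, MeasurableSet A → Measurable fun x => ν (u x ⁻¹' A)
  lintegral_measure : ∀ A : Set Y, MeasurableSet A → ∫⁻ x, ν (u x ⁻¹' A) ∂μ = ρ A

namespace IsDisintegration

variable {X H Y : Type*} {mX : MeasurableSpace X} {mH : MeasurableSpace H}
  {mY : MeasurableSpace Y} {μ : Measure X} {ν : Measure H} {ρ : Measure Y} {u : X → H → Y}

theorem exists_kernel (h : IsDisintegration μ ν ρ u) :
    ∃ κ : ProbabilityTheory.Kernel X Y, (∀ x, κ x = ν.map (u x)) ∧ ρ = μ.bind κ := by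
  have hκ : Measurable fun x => ν.map (u x) := Measure.measurable_of_measurable_coe _ fun A hA => by
    simp only [Measure.map_apply (h.measurable_section _) hA]
    exact h.measurable_measure A hA
  refine ⟨⟨_, hκ⟩, fun x => rfl, Measure.ext fun A hA => ?_⟩
  rw [Measure.bind_apply hA (ProbabilityTheory.Kernel.aemeasurable _), ← h.lintegral_measure A hA]
  exact lintegral_congr fun x => (Measure.map_apply (h.measurable_section x) hA).symm

/-- By the `π`-`λ` theorem, a disintegration need only be verified on a generating `π`-system. -/
theorem of_generateFrom [IsProbabilityMeasure μ] [IsProbabilityMeasure ν] [IsProbabilityMeasure ρ]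
    (hu : ∀ x, Measurable (u x)) {C : Set (Set Y)} (hC : mY = MeasurableSpace.generateFrom C)
    (hpi : IsPiSystem C) (hmeas : ∀ A ∈ C, Measurable fun x => ν (u x ⁻¹' A))
    (hint : ∀ A ∈ C, ∫⁻ x, ν (u x ⁻¹' A) ∂μ = ρ A) : IsDisintegration μ ν ρ u := by
  have hCm : ∀ A ∈ C, MeasurableSet A := fun A hA =>
    hC ▸ MeasurableSpace.measurableSet_generateFrom hA
  have (x : X) : IsProbabilityMeasure (ν.map (u x)) :=
    Measure.isProbabilityMeasure_map (hu x).aemeasurable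
  have hκ : Measurable fun x => ν.map (u x) := by
    refine .measure_of_isPiSystem_of_isProbabilityMeasure hC hpi fun A hA => ?_
    simp only [Measure.map_apply (hu _) (hCm A hA)]
    exact hmeas A hA
  have hbind : ∀ A, MeasurableSet A →
      μ.bind (fun x => ν.map (u x)) A = ∫⁻ x, ν (u x ⁻¹' A) ∂μ := fun A hA => by
    rw [Measure.bind_apply hA hκ.aemeasurable]
    exact lintegral_congr fun x => Measure.map_apply (hu x) hA
  have hρ : ρ = μ.bind fun x => ν.map (u x) := by
    refine ext_of_generate_finite C hC hpi (fun A hA => ?_) ?_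
    · rw [hbind A (hCm A hA), hint A hA]
    · rw [hbind _ .univ]
      simp
  refine ⟨hu, fun A hA => ?_, fun A hA => ?_⟩
  · have h : Measurable fun x => ν.map (u x) A := (Measure.measurable_coe hA).comp hκ
    simpa only [Measure.map_apply (hu _) hA] using h
  · rw [hρ, hbind A hA]

theorem map {Z : Type*} {mZ : MeasurableSpace Z} {e : Y → Z} (h : IsDisintegration μ ν ρ u)
    (he : Measurable e) : IsDisintegration μ ν (ρ.map e) fun x y => e (u x y) where
  measurable_section x := he.comp (h.measurable_section x)
  measurable_measure A hA := h.measurable_measure _ (he hA)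
  lintegral_measure A hA := by
    rw [Measure.map_apply he hA]
    exact h.lintegral_measure _ (he hA)

theorem measurable_lintegral (h : IsDisintegration μ ν ρ u) {f : Y → ℝ≥0∞} (hf : Measurable f) :
    Measurable fun x => ∫⁻ y, f (u x y) ∂ν := by
  obtain ⟨κ, hκ, -⟩ := h.exists_kernel
  simpa only [hκ, lintegral_map hf (h.measurable_section _)] using hf.lintegral_kernel (κ := κ)

theorem lintegral_lintegral (h : IsDisintegration μ ν ρ u) {f : Y → ℝ≥0∞} (hf : Measurable f) :
    ∫⁻ x, ∫⁻ y, f (u x y) ∂ν ∂μ = ∫⁻ z, f z ∂ρ := by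
  obtain ⟨κ, hκ, rfl⟩ := h.exists_kernel
  rw [Measure.lintegral_bind κ.aemeasurable hf.aemeasurable]
  simp only [hκ, lintegral_map hf (h.measurable_section _)]

theorem measurable_integral (h : IsDisintegration μ ν ρ u) {f : Y → ℝ} (hf : Measurable f) :
    Measurable fun x => ∫ y, f (u x y) ∂ν := by
  obtain ⟨κ, hκ, -⟩ := h.exists_kernel
  simpa only [hκ, integral_map (h.measurable_section _).aemeasurable hf.aestronglyMeasurable] using
    (hf.stronglyMeasurable.integral_kernel (κ := κ)).measurable

theorem ae_integrable (h : IsDisintegration μ ν ρ u) {f : Y → ℝ} (hf : Measurable f)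
    (hi : Integrable f ρ) : ∀ᵐ x ∂μ, Integrable (fun y => f (u x y)) ν := by
  obtain ⟨κ, hκ, rfl⟩ := h.exists_kernel
  filter_upwards [((Measure.integrable_comp_iff hi.1).1 hi).1] with x hx
  rw [hκ, integrable_map_measure hf.aestronglyMeasurable (h.measurable_section x).aemeasurable]
    at hx
  exact hx

theorem integrable_integral (h : IsDisintegration μ ν ρ u) {f : Y → ℝ} (hf : Measurable f)
    (hi : Integrable f ρ) : Integrable (fun x => ∫ y, f (u x y) ∂ν) μ := by
  obtain ⟨κ, hκ, rfl⟩ := h.exists_kernel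
  rw [Measure.comp_eq_comp_const_apply] at hi
  simpa only [hκ, integral_map (h.measurable_section _).aemeasurable hf.aestronglyMeasurable,
    ProbabilityTheory.Kernel.const_apply] using hi.integral_comp

theorem integral_integral (h : IsDisintegration μ ν ρ u) {f : Y → ℝ} (hf : Measurable f)
    (hi : Integrable f ρ) : ∫ x, ∫ y, f (u x y) ∂ν ∂μ = ∫ z, f z ∂ρ := by
  obtain ⟨κ, hκ, rfl⟩ := h.exists_kernel
  rw [Measure.comp_eq_comp_const_apply] at hi ⊢
  rw [ProbabilityTheory.Kernel.integral_comp hi]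
  simp only [hκ, integral_map (h.measurable_section _).aemeasurable hf.aestronglyMeasurable,
    ProbabilityTheory.Kernel.const_apply]

end IsDisintegration

/-- Fubini's theorem for functions amounts to Fubini's theorem for sets, in both orders. -/
theorem fubiniHolds_iff_isDisintegration {G : Type*} {B : MeasurableSpace G} {μ : Measure G}
    {B₂ : MeasurableSpace (G × G)} {μ₂ : @Measure (G × G) B₂} :
    FubiniHolds B μ B₂ μ₂ ↔
      IsDisintegration μ μ μ₂ (fun g h => (g, h)) ∧
      IsDisintegration μ μ μ₂ (fun g h => (h, g)) := by
  constructor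
  · intro hF
    -- A set is measurable when its real indicator is, so sections of sets are sections of functions.
    have hsec : ∀ g : G, (Measurable[B, B₂] fun h => (g, h)) ∧
        Measurable[B, B₂] fun h => (h, g) := by
      classical
      have hset : ∀ A : Set (G × G), ∀ u : G → G × G,
          (Measurable[B] fun h => A.indicator (fun _ => (1 : ℝ)) (u h)) →
          MeasurableSet[B] (u ⁻¹' A) := fun A u hu => by
        convert hu (measurableSet_singleton (1 : ℝ)) using 1
        ext h
        by_cases hh : u h ∈ A <;> simp [hh]
      have hone : ∀ A : Set (G × G), MeasurableSet[B₂] A →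
          Measurable[B₂] (A.indicator fun _ => (1 : ℝ)) := fun A hA => measurable_const.indicator hA
      exact fun g => ⟨fun A hA => hset A _ (hF.measurable_sections _ (hone A hA) g).1,
        fun A hA => hset A _ (hF.measurable_sections _ (hone A hA) g).2⟩
    have hind : ∀ A : Set (G × G), ∀ u : G → G × G, Measurable[B, B₂] u → MeasurableSet[B₂] A →
        ∫⁻ h, A.indicator (fun _ => (1 : ℝ≥0∞)) (u h) ∂μ = μ (u ⁻¹' A) := fun A u hu hA =>
      (lintegral_indicator_const (hu hA) 1).trans (one_mul _)
    have hone : ∀ A : Set (G × G), MeasurableSet[B₂] A →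
        ∫⁻ p, A.indicator (fun _ => (1 : ℝ≥0∞)) p ∂μ₂ = μ₂ A := fun A hA =>
      (lintegral_indicator_const hA 1).trans (one_mul _)
    have hl : ∀ A, MeasurableSet[B₂] A → _ := fun A hA =>
      hF.lintegral_eq (A.indicator fun _ => 1) (measurable_const.indicator hA)
    refine ⟨⟨fun g => (hsec g).1, fun A hA => ?_, fun A hA => ?_⟩,
      ⟨fun g => (hsec g).2, fun A hA => ?_, fun A hA => ?_⟩⟩
    · simpa only [hind A _ (hsec _).1 hA] using (hl A hA).1
    · simpa only [hind A _ (hsec _).1 hA, hone A hA] using (hl A hA).2.2.2.symm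
    · simpa only [hind A _ (hsec _).2 hA] using (hl A hA).2.1
    · simpa only [hind A _ (hsec _).2 hA, hone A hA] using (hl A hA).2.2.1
  · rintro ⟨h₁, h₂⟩
    exact
      { measurable_sections := fun f hf g =>
          ⟨hf.comp (h₁.measurable_section g), hf.comp (h₂.measurable_section g)⟩
        measurable_integral := fun f hf => ⟨h₁.measurable_integral hf, h₂.measurable_integral hf⟩
        lintegral_eq := fun f hf => ⟨h₁.measurable_lintegral hf, h₂.measurable_lintegral hf,
          h₂.lintegral_lintegral hf, (h₁.lintegral_lintegral hf).symm⟩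
        ae_integrable := fun f hf hi => ⟨h₁.ae_integrable hf hi, h₂.ae_integrable hf hi⟩
        integrable_integral := fun f hf hi =>
          ⟨h₁.integrable_integral hf hi, h₂.integrable_integral hf hi⟩
        integral_eq := fun f hf hi =>
          ⟨h₂.integral_integral hf hi, (h₁.integral_integral hf hi).symm⟩ }

/-- Fubini's theorem for rectangles determines the restriction to the product `σ`-algebra. -/
theorem IsDisintegration.trim_eq_prod {G : Type*} {B : MeasurableSpace G} {μ : Measure G}
    {B₂ : MeasurableSpace (G × G)} {μ₂ : @Measure (G × G) B₂} [IsProbabilityMeasure μ]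
    (h : IsDisintegration μ μ μ₂ (fun g h => (g, h))) (hle : B.prod B ≤ B₂) :
    @Measure.trim (G × G) (B.prod B) B₂ μ₂ hle = @Measure.prod G G B B μ μ := by
  symm
  refine @Measure.prod_eq G G B B μ _ μ _ _ fun s t hs ht => ?_
  have hst : MeasurableSet[B.prod B] (s ×ˢ t) := @MeasurableSet.prod _ _ B B _ _ hs ht
  rw [trim_measurableSet_eq hle hst, ← h.lintegral_measure _ (hle _ hst)]
  have heq : ∀ g, μ ((fun h => (g, h)) ⁻¹' s ×ˢ t) = s.indicator (fun _ => μ t) g := fun g => by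
    classical
    by_cases hg : g ∈ s
    · simp [Set.mk_preimage_prod_right hg, hg]
    · simp [Set.mk_preimage_prod_right_eq_empty hg, hg]
  simp only [heq]
  rw [lintegral_indicator_const hs, mul_comm]

/-! ### Internal maps and disintegrations of Loeb measures -/

namespace Ultraproduct

variable {α : Ultrafilter ℕ}

theorem preimage_internalSet {X Y : ℕ → Type*} {t : ∀ n, X n → Y n}
    {T : Ultraproduct α X → Ultraproduct α Y}
    (hT : ∀ x : ∀ n, X n, T (mk α x) = mk α fun n => t n (x n)) (A : ∀ n, Set (Y n)) :
    T ⁻¹' internalSet α A = internalSet α fun n => t n ⁻¹' A n := by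
  ext x
  obtain ⟨x, rfl⟩ := mk_surjective x
  rw [Set.mem_preimage, hT]
  exact Iff.rfl

/-- An internal map with measurable components is Loeb measurable. -/
theorem measurable_of_mk {X Y : ℕ → Type*} {B : ∀ n, MeasurableSpace (X n)}
    {D : ∀ n, MeasurableSpace (Y n)} {t : ∀ n, X n → Y n} (ht : ∀ n, Measurable (t n))
    {T : Ultraproduct α X → Ultraproduct α Y}
    (hT : ∀ x : ∀ n, X n, T (mk α x) = mk α fun n => t n (x n)) :
    Measurable[loebSpace α B, loebSpace α D] T :=
  measurable_loebSpace fun A hA => by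
    rw [preimage_internalSet hT]
    exact measurableSet_internalSet fun n => ht n (hA n)

/-- An internal map with measure preserving components preserves the Loeb measures. -/
theorem measurePreserving_of_mk {X Y : ℕ → Type*} [∀ n, Nonempty (X n)] [∀ n, Nonempty (Y n)]
    {B : ∀ n, MeasurableSpace (X n)} {D : ∀ n, MeasurableSpace (Y n)}
    {μ : ∀ n, Measure (X n)} {ν : ∀ n, Measure (Y n)} (hμ : ∀ n, IsProbabilityMeasure (μ n))
    {t : ∀ n, X n → Y n} (ht : ∀ n, MeasurePreserving (t n) (μ n) (ν n))
    {T : Ultraproduct α X → Ultraproduct α Y}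
    (hT : ∀ x : ∀ n, X n, T (mk α x) = mk α fun n => t n (x n)) :
    @MeasurePreserving _ _ (loebSpace α B) (loebSpace α D) T (loebMeasure α B μ)
      (loebMeasure α D ν) := by
  let _ := loebSpace α B
  let _ := loebSpace α D
  have hTm : Measurable[loebSpace α B, loebSpace α D] T :=
    measurable_of_mk (fun n => (ht n).measurable) hT
  have := isProbabilityMeasure_loebMeasure (α := α) hμ
  have hmap (A : ∀ n, Set (Y n)) (hA : ∀ n, MeasurableSet[D n] (A n)) :
      (loebMeasure α B μ).map T (internalSet α A) = loebMeasure α D ν (internalSet α A) := by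
    rw [Measure.map_apply hTm (measurableSet_internalSet hA), preimage_internalSet hT]
    refine tendsto_nhds_unique (tendsto_loebMeasure μ fun n => (ht n).measurable (hA n)) ?_
    exact (tendsto_loebMeasure ν hA).congr fun n =>
      ((ht n).measure_preimage (hA n).nullMeasurableSet).symm
  have : IsProbabilityMeasure ((loebMeasure α B μ).map T) :=
    Measure.isProbabilityMeasure_map hTm.aemeasurable
  refine ⟨hTm, ext_of_generate_finite _ rfl (isPiSystem_internalSet D) ?_ ?_⟩
  · rintro _ ⟨A, hA, rfl⟩
    exact hmap A hA
  · rw [← internalSet_univ]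
    exact hmap _ fun n => MeasurableSet.univ

/-- The ultraproduct of a sequence of binary maps. -/
def map₂ (α : Ultrafilter ℕ) {X H Y : ℕ → Type*} (u : ∀ n, X n → H n → Y n) :
    Ultraproduct α X → Ultraproduct α H → Ultraproduct α Y :=
  Quotient.map₂ (fun x y n => u n (x n) (y n)) fun _ _ hx _ _ hy => by
    filter_upwards [hx, hy] with n h₁ h₂
    simp only [h₁, h₂]

/-- Disintegrations pass to ultraproducts: on an internal set `∏ A n`, the measure of the section
at `x` is the limit of the measures of the sections of `A n`, which are functions with values in
`[0, 1]`, and integration commutes with limits of such functions. -/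
theorem isDisintegration_map₂ {X H Y : ℕ → Type*} [∀ n, Nonempty (X n)] [∀ n, Nonempty (H n)]
    [∀ n, Nonempty (Y n)] {B : ∀ n, MeasurableSpace (X n)} {C : ∀ n, MeasurableSpace (H n)}
    {D : ∀ n, MeasurableSpace (Y n)} {μ : ∀ n, Measure (X n)} {ν : ∀ n, Measure (H n)}
    {ρ : ∀ n, Measure (Y n)} (hμ : ∀ n, IsProbabilityMeasure (μ n))
    (hν : ∀ n, IsProbabilityMeasure (ν n)) (hρ : ∀ n, IsProbabilityMeasure (ρ n))
    {u : ∀ n, X n → H n → Y n} (hu : ∀ n, IsDisintegration (μ n) (ν n) (ρ n) (u n)) :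
    IsDisintegration (loebMeasure α B μ) (loebMeasure α C ν) (loebMeasure α D ρ) (map₂ α u) := by
  have := isProbabilityMeasure_loebMeasure (α := α) hμ
  have := isProbabilityMeasure_loebMeasure (α := α) hν
  have := isProbabilityMeasure_loebMeasure (α := α) hρ
  have hsec : ∀ (x : ∀ n, X n) (h : ∀ n, H n),
      map₂ α u (mk α x) (mk α h) = mk α fun n => u n (x n) (h n) := fun _ _ => rfl
  have hlim : ∀ A : ∀ n, Set (Y n), (∀ n, MeasurableSet[D n] (A n)) → ∀ x : ∀ n, X n,
      Tendsto (fun n => ν n (u n (x n) ⁻¹' A n)) (α : Filter ℕ)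
        (𝓝 (loebMeasure α C ν (map₂ α u (mk α x) ⁻¹' internalSet α A))) := fun A hA x => by
    rw [preimage_internalSet (hsec x)]
    exact tendsto_loebMeasure ν fun n => (hu n).measurable_section (x n) (hA n)
  refine .of_generateFrom (fun x => ?_) rfl (isPiSystem_internalSet D) ?_ ?_
  · obtain ⟨x, rfl⟩ := mk_surjective x
    exact measurable_of_mk (fun n => (hu n).measurable_section (x n)) (hsec x)
  · rintro _ ⟨A, hA, rfl⟩
    exact measurable_of_tendsto_mk (fun n => (hu n).measurable_measure _ (hA n)) (hlim A hA)
  · rintro _ ⟨A, hA, rfl⟩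
    refine tendsto_nhds_unique ?_ (tendsto_loebMeasure ρ hA)
    refine (tendsto_lintegral_loebMeasure hμ (fun n => (hu n).measurable_measure _ (hA n))
      (fun n x => prob_le_one) (hlim A hA)).congr fun n => ?_
    exact (hu n).lintegral_measure _ (hA n)

/-! ### The square of an ultraproduct -/

section Square

variable {G : ℕ → Type*}

theorem measurable_toSquare (B₂ : ∀ n, MeasurableSpace (G n × G n)) :
    Measurable[loebSpace α B₂, loebSpaceSquare α B₂] (toSquare α) :=
  fun _ h => h

theorem tendsto_loebMeasureSquare [∀ n, Nonempty (G n)] {B₂ : ∀ n, MeasurableSpace (G n × G n)}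
    (μ₂ : ∀ n, @Measure (G n × G n) (B₂ n)) {A : ∀ n, Set (G n × G n)}
    (hA : ∀ n, MeasurableSet[B₂ n] (A n)) :
    Tendsto (fun n => μ₂ n (A n)) (α : Filter ℕ)
      (𝓝 (loebMeasureSquare α B₂ μ₂ (toSquare α '' internalSet α A))) := by
  have hpre := Set.preimage_image_eq (internalSet α A) (toSquare_bijective α).1
  have hm : MeasurableSet[loebSpaceSquare α B₂] (toSquare α '' internalSet α A) := by
    change MeasurableSet[loebSpace α B₂] (toSquare α ⁻¹' (toSquare α '' internalSet α A))
    rw [hpre]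
    exact measurableSet_internalSet hA
  rw [loebMeasureSquare, Measure.map_apply (measurable_toSquare B₂) hm, hpre]
  exact tendsto_loebMeasure μ₂ hA

/-- Fubini's theorem passes to the Loeb measures. -/
theorem fubiniHolds_loebMeasureSquare [∀ n, Nonempty (G n)] {B : ∀ n, MeasurableSpace (G n)}
    {μ : ∀ n, @Measure (G n) (B n)} {B₂ : ∀ n, MeasurableSpace (G n × G n)}
    {μ₂ : ∀ n, @Measure (G n × G n) (B₂ n)} (hμ : ∀ n, @IsProbabilityMeasure _ (B n) (μ n))
    (hμ₂ : ∀ n, @IsProbabilityMeasure _ (B₂ n) (μ₂ n))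
    (hF : ∀ n, FubiniHolds (B n) (μ n) (B₂ n) (μ₂ n)) :
    FubiniHolds (loebSpace α B) (loebMeasure α B μ) (loebSpaceSquare α B₂)
      (loebMeasureSquare α B₂ μ₂) := by
  have hd := fun n => fubiniHolds_iff_isDisintegration.1 (hF n)
  have h₁ := (isDisintegration_map₂ (α := α) hμ hμ hμ₂ fun n => (hd n).1).map
    (measurable_toSquare B₂)
  have h₂ := (isDisintegration_map₂ (α := α) hμ hμ hμ₂ fun n => (hd n).2).map
    (measurable_toSquare B₂)
  have e₁ : (fun g h => toSquare α (map₂ α (fun n (g h : G n) => (g, h)) g h)) =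
      fun g h => (g, h) := by
    funext g h
    obtain ⟨g, rfl⟩ := mk_surjective g
    obtain ⟨h, rfl⟩ := mk_surjective h
    rfl
  have e₂ : (fun g h => toSquare α (map₂ α (fun n (g h : G n) => (h, g)) g h)) =
      fun g h => (h, g) := by
    funext g h
    obtain ⟨g, rfl⟩ := mk_surjective g
    obtain ⟨h, rfl⟩ := mk_surjective h
    rfl
  rw [e₁] at h₁
  rw [e₂] at h₂
  exact fubiniHolds_iff_isDisintegration.2 ⟨h₁, h₂⟩

end Square

end Ultraproduct

/-! ### Ultraproducts of probability groups -/

/-- Translations are measurable because sections of the multiplication are. -/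
theorem IsProbabilityGroup.measurePreserving_mul {G : Type*} [Group G] {B : MeasurableSpace G}
    {μ : Measure G} {B₂ : MeasurableSpace (G × G)} {μ₂ : @Measure (G × G) B₂}
    (h : IsProbabilityGroup G B μ B₂ μ₂) (g : G) :
    MeasurePreserving (fun x => g * x) μ μ ∧ MeasurePreserving (fun x => x * g) μ μ := by
  obtain ⟨h₁, h₂⟩ := fubiniHolds_iff_isDisintegration.1 h.fubini
  have m₁ : Measurable fun x => g * x := h.measurable_mul.comp (h₁.measurable_section g)
  have m₂ : Measurable fun x => x * g := h.measurable_mul.comp (h₂.measurable_section g)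
  refine ⟨⟨m₁, Measure.ext fun A hA => ?_⟩, ⟨m₂, Measure.ext fun A hA => ?_⟩⟩
  · rw [Measure.map_apply m₁ hA, h.mul_left_invariant g A hA]
  · rw [Measure.map_apply m₂ hA, h.mul_right_invariant g A hA]

theorem IsProbabilityGroup.measurePreserving_inv {G : Type*} [Group G] {B : MeasurableSpace G}
    {μ : Measure G} {B₂ : MeasurableSpace (G × G)} {μ₂ : @Measure (G × G) B₂}
    (h : IsProbabilityGroup G B μ B₂ μ₂) : MeasurePreserving (fun x => x⁻¹) μ μ :=
  ⟨h.measurable_inv, Measure.ext fun A hA => by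
    rw [Measure.map_apply h.measurable_inv hA, h.inv_invariant A hA]⟩

/-- Each axiom other than Fubini's theorem is about internal maps with measurable, or measure
preserving, components. -/
theorem Ultraproduct.isProbabilityGroup (α : Ultrafilter ℕ) {G : ℕ → Type*} [∀ n, Group (G n)]
    {B : ∀ n, MeasurableSpace (G n)} {μ : ∀ n, @Measure (G n) (B n)}
    {B₂ : ∀ n, MeasurableSpace (G n × G n)} {μ₂ : ∀ n, @Measure (G n × G n) (B₂ n)}
    (hG : ∀ n, IsProbabilityGroup (G n) (B n) (μ n) (B₂ n) (μ₂ n)) :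
    IsProbabilityGroup (Ultraproduct α G) (loebSpace α B) (loebMeasure α B μ)
      (loebSpaceSquare α B₂) (loebMeasureSquare α B₂ μ₂) := by
  have hμ := fun n => (hG n).isProbabilityMeasure
  have hμ₂ := fun n => (hG n).isProbabilityMeasure₂
  have hF : FubiniHolds (loebSpace α B) (loebMeasure α B μ) (loebSpaceSquare α B₂)
      (loebMeasureSquare α B₂ μ₂) :=
    fubiniHolds_loebMeasureSquare hμ hμ₂ fun n => (hG n).fubini
  have hprob := isProbabilityMeasure_loebMeasure (α := α) hμ
  have hprob₂ := isProbabilityMeasure_loebMeasure (α := α) hμ₂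
  have hprob₂' : IsProbabilityMeasure (loebMeasureSquare α B₂ μ₂) := by
    let _ := loebSpace α B₂
    let _ := loebSpaceSquare α B₂
    exact Measure.isProbabilityMeasure_map (measurable_toSquare B₂).aemeasurable
  have hfst : Measurable[loebSpaceSquare α B₂, loebSpace α B]
      (Prod.fst : Ultraproduct α G × Ultraproduct α G → _) := by
    have h : Measurable[loebSpace α B₂, loebSpace α B] fun p => (toSquare α p).1 :=
      measurable_of_mk (t := fun n => Prod.fst)
        (fun n => (@measurable_fst _ _ (B n) (B n)).mono (hG n).prod_le le_rfl) fun _ => rfl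
    exact fun A hA => h hA
  have hsnd : Measurable[loebSpaceSquare α B₂, loebSpace α B]
      (Prod.snd : Ultraproduct α G × Ultraproduct α G → _) := by
    have h : Measurable[loebSpace α B₂, loebSpace α B] fun p => (toSquare α p).2 :=
      measurable_of_mk (t := fun n => Prod.snd)
        (fun n => (@measurable_snd _ _ (B n) (B n)).mono (hG n).prod_le le_rfl) fun _ => rfl
    exact fun A hA => h hA
  have hle : (loebSpace α B).prod (loebSpace α B) ≤ loebSpaceSquare α B₂ :=
    sup_le hfst.comap_le hsnd.comap_le
  refine
    { isProbabilityMeasure := hprob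
      isProbabilityMeasure₂ := hprob₂'
      prod_le := hle
      trim_eq_prod := (fubiniHolds_iff_isDisintegration.1 hF).1.trim_eq_prod hle
      measurable_mul := ?_
      measurable_inv := measurable_of_mk (fun n => (hG n).measurable_inv) fun _ => rfl
      mul_left_invariant := ?_
      mul_right_invariant := ?_
      inv_invariant := ?_
      fubini := hF }
  · have h : Measurable[loebSpace α B₂, loebSpace α B]
        fun p => (toSquare α p).1 * (toSquare α p).2 :=
      measurable_of_mk (fun n => (hG n).measurable_mul) fun _ => rfl
    exact fun A hA => h hA
  · intro g A hA
    let _ := loebSpace α B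
    obtain ⟨g, rfl⟩ := mk_surjective g
    exact (measurePreserving_of_mk hμ (fun n => ((hG n).measurePreserving_mul (g n)).1)
      (T := fun x => mk α g * x) fun _ => rfl).measure_preimage hA.nullMeasurableSet
  · intro g A hA
    let _ := loebSpace α B
    obtain ⟨g, rfl⟩ := mk_surjective g
    exact (measurePreserving_of_mk hμ (fun n => ((hG n).measurePreserving_mul (g n)).2)
      (T := fun x => x * mk α g) fun _ => rfl).measure_preimage hA.nullMeasurableSet
  · intro A hA
    let _ := loebSpace α B
    exact (measurePreserving_of_mk hμ (fun n => (hG n).measurePreserving_inv)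
      (T := fun x => x⁻¹) fun _ => rfl).measure_preimage hA.nullMeasurableSet

theorem mainTheorem5 (α : Ultrafilter ℕ) (G : ℕ → Type*) [∀ n, Group (G n)]
    (B : ∀ n, MeasurableSpace (G n)) (μ : ∀ n, @Measure (G n) (B n))
    (B₂ : ∀ n, MeasurableSpace (G n × G n)) (μ₂ : ∀ n, @Measure (G n × G n) (B₂ n))
    (hG : ∀ n, IsProbabilityGroup (G n) (B n) (μ n) (B₂ n) (μ₂ n)) :
    (∀ A : ∀ n, Set (G n), (∀ n, MeasurableSet[B n] (A n)) →
      Tendsto (fun n => μ n (A n)) (α : Filter ℕ)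
        (𝓝 (Ultraproduct.loebMeasure α B μ (Ultraproduct.internalSet α A)))) ∧
    (∀ A : ∀ n, Set (G n × G n), (∀ n, MeasurableSet[B₂ n] (A n)) →
      Tendsto (fun n => μ₂ n (A n)) (α : Filter ℕ)
        (𝓝 (Ultraproduct.loebMeasureSquare α B₂ μ₂
          (Ultraproduct.toSquare α '' Ultraproduct.internalSet α A)))) ∧
    IsProbabilityGroup (Ultraproduct α G)
      (Ultraproduct.loebSpace α B) (Ultraproduct.loebMeasure α B μ)
      (Ultraproduct.loebSpaceSquare α B₂) (Ultraproduct.loebMeasureSquare α B₂ μ₂) :=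
  ⟨fun _ hA => Ultraproduct.tendsto_loebMeasure μ hA,
    fun _ hA => Ultraproduct.tendsto_loebMeasureSquare μ₂ hA, Ultraproduct.isProbabilityGroup α hG⟩
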